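/- Let $n,m\ge 0$ be integers, let $E=\mathbb{C}^n$ and $F=\mathbb{C}^m$ with standard orthonormal bases $\{e_i\}$, $\{f_j\}$, and let $u=(u_{(i,j),(k,l)})$ be a unitary $nm\times nm$ matrix with rows and columns indexed by $\{1,\dots,n\}\times\{1,\dots,m\}$. Identify $E\otimes F$ with $F\otimes E$ by $e_i\otimes f_j=\sum_{k,l}u_{(i,j),(k,l)}\,f_l\otimes e_k$, equivalently $f_l\otimes e_k=\sum_{i,j}\overline{u_{(i,j),(k,l)}}\,e_i\otimes f_j$. On the Fock space $\mathcal{F}=\bigoplus_{k,l\ge 0}E^{\otimes k}\otimes F^{\otimes l}$ (Hilbert space direct sum) let $L_e x=e\otimes x$ for $e\in E$ and $L_f x=f\otimes x$ for $f\in F$, where $f\otimes x$ is rewritten as an element of $\mathcal{F}$ by repeated use of the identification. Let $\mathbb{C}[\mathbb{F}_u^+]$ be the algebra of operators generated by the unital semigroup $\mathbb{F}_u^+$ generated by all $L_e$ and $L_f$ ($e\in E$, $f\in F$), let $\mathcal{A}_u$ be its norm closure and $\mathcal{L}_u$ its closure in the weak* (ultraweak) topology of $B(\mathcal{F})$. Let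 $\mathbb{B}_k$ be the open Euclidean unit ball of $\mathbb{C}^k$, and put $$V_u=\Big\{(z,w)\in\mathbb{C}^n\times\mathbb{C}^m:\ z_iw_j=\sum_{k,l}u_{(i,j),(k,l)}z_kw_l\ \text{ for all } i,j\Big\},\qquad \Omega_u=V_u\cap(\overline{\mathbb{B}}_n\times\overline{\mathbb{B}}_m).$$ A character is a nonzero multiplicative linear functional. (1) The map $\alpha\mapsto\big((\alpha(L_{e_i}))_i,(\alpha(L_{f_j}))_j\big)$ is a bijection from the set of characters of $\mathbb{C}[\mathbb{F}_u^+]$ onto $V_u$. (2) The same formula defines a homeomorphism from the space $\mathcal{M}(\mathcal{A}_u)$ of (continuous) characters of $\mathcal{A}_u$, with the weak* topology, onto $\Omega_u$. (3) For $(z,w)\in\Omega_u$ let $\alpha_{(z,w)}$ be the character of $\mathcal{A}_u$ corresponding to it under (2). Then $\alpha_{(z,w)}$ extends to a weak*-continuous character of $\mathcal{L}_u$ if and only if $(z,w)\in\mathbb{B}_n\times\mathbb{B}_m$. -/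

import Mathlib

noncomputable section

namespace UnitaryRelation

/-! ### The weak-star (ultraweak) topology on the bounded operators of a Hilbert space -/

section Ultraweak

variable (H : Type*) [NormedAddCommGroup H] [InnerProductSpace ℂ H]

/-- Pairs of square-summable sequences of vectors; they represent the normal functionals
`T ↦ ∑ₖ ⟨xₖ, T yₖ⟩`, that is, the predual of the bounded operators. -/
abbrev SqSummablePair : Type _ :=
  {p : (ℕ → H) × (ℕ → H) //
    Summable (fun k => ‖p.1 k‖ ^ 2) ∧ Summable (fun k => ‖p.2 k‖ ^ 2)}

variable {H}

/-- The normal functional `T ↦ ∑ₖ ⟨xₖ, T yₖ⟩`. -/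
def normalFunctional (p : SqSummablePair H) (T : H →L[ℂ] H) : ℂ :=
  ∑' k, inner ℂ (p.1.1 k) (T (p.1.2 k))

variable (H) in
/-- The weak-star (ultraweak, `σ`-weak) topology on the bounded operators: the coarsest topology
for which all normal functionals are continuous. -/
abbrev weakStar : TopologicalSpace (H →L[ℂ] H) :=
  TopologicalSpace.induced (fun T (p : SqSummablePair H) => normalFunctional p T)
    Pi.topologicalSpace

theorem norm_inner_le (p : SqSummablePair H) (T : H →L[ℂ] H) (k : ℕ) :
    ‖inner ℂ (p.1.1 k) (T (p.1.2 k))‖ ≤ ‖T‖ * (‖p.1.1 k‖ ^ 2 + ‖p.1.2 k‖ ^ 2) := by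
  have h1 := norm_inner_le_norm (𝕜 := ℂ) (p.1.1 k) (T (p.1.2 k))
  have h2 : ‖p.1.1 k‖ * ‖T (p.1.2 k)‖ ≤ ‖p.1.1 k‖ * (‖T‖ * ‖p.1.2 k‖) :=
    mul_le_mul_of_nonneg_left (T.le_opNorm _) (norm_nonneg _)
  have h3 : ‖p.1.1 k‖ * ‖p.1.2 k‖ ≤ ‖p.1.1 k‖ ^ 2 + ‖p.1.2 k‖ ^ 2 := by
    nlinarith [sq_nonneg (‖p.1.1 k‖ - ‖p.1.2 k‖), norm_nonneg (p.1.1 k), norm_nonneg (p.1.2 k)]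
  have h4 := mul_le_mul_of_nonneg_left h3 (norm_nonneg T)
  linarith [mul_left_comm ‖p.1.1 k‖ ‖T‖ ‖p.1.2 k‖]

theorem normalFunctional_summable_norm (p : SqSummablePair H) (T : H →L[ℂ] H) :
    Summable fun k => ‖inner ℂ (p.1.1 k) (T (p.1.2 k))‖ :=
  Summable.of_nonneg_of_le (fun _ => norm_nonneg _) (norm_inner_le p T)
    ((p.2.1.add p.2.2).mul_left ‖T‖)

theorem normalFunctional_add (p : SqSummablePair H) (S T : H →L[ℂ] H) :
    normalFunctional p (S + T) = normalFunctional p S + normalFunctional p T := by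
  unfold normalFunctional
  rw [← (normalFunctional_summable_norm p S).of_norm.tsum_add
    (normalFunctional_summable_norm p T).of_norm]
  simp

theorem normalFunctional_smul (p : SqSummablePair H) (c : ℂ) (T : H →L[ℂ] H) :
    normalFunctional p (c • T) = c * normalFunctional p T := by
  unfold normalFunctional
  rw [← tsum_mul_left]
  simp

theorem continuous_normalFunctional (p : SqSummablePair H) :
    Continuous (normalFunctional p) := by
  let f : (H →L[ℂ] H) →ₗ[ℂ] ℂ :=
    { toFun := normalFunctional p
      map_add' := normalFunctional_add p
      map_smul' := fun c T => by simp [normalFunctional_smul] }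
  have hb : ∀ T, ‖f T‖ ≤ (∑' k, (‖p.1.1 k‖ ^ 2 + ‖p.1.2 k‖ ^ 2)) * ‖T‖ := by
    intro T
    refine (norm_tsum_le_tsum_norm (normalFunctional_summable_norm p T)).trans ?_
    rw [← tsum_mul_right]
    refine (normalFunctional_summable_norm p T).tsum_le_tsum (fun k => ?_)
      ((p.2.1.add p.2.2).mul_right ‖T‖)
    exact (norm_inner_le p T k).trans_eq (mul_comm _ _)
  exact (f.mkContinuous _ hb).continuous

theorem norm_le_weakStar :
    (inferInstance : TopologicalSpace (H →L[ℂ] H)) ≤ weakStar H :=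
  continuous_iff_le_induced.mp (continuous_pi continuous_normalFunctional)

theorem weakStar_continuous_normalFunctional (p : SqSummablePair H) :
    @Continuous _ _ (weakStar H) _ (normalFunctional p) := by
  let := weakStar H
  have h : Continuous (fun (T : H →L[ℂ] H) (p : SqSummablePair H) => normalFunctional p T) :=
    continuous_induced_dom
  exact continuous_pi_iff.mp h p

theorem summable_sq_map (A : H →L[ℂ] H) {x : ℕ → H} (hx : Summable fun k => ‖x k‖ ^ 2) :
    Summable fun k => ‖A (x k)‖ ^ 2 := by
  refine Summable.of_nonneg_of_le (fun _ => by positivity) (fun k => ?_) (hx.mul_left (‖A‖ ^ 2))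
  rw [← mul_pow]
  exact pow_le_pow_left₀ (norm_nonneg _) (A.le_opNorm _) 2

/-- Addition is jointly, and multiplication separately, weak-star continuous. -/
theorem weakStar_isSemitopologicalSemiring [CompleteSpace H] :
    @IsSemitopologicalSemiring (H →L[ℂ] H) (weakStar H) _ := by
  let := weakStar H
  refine
    { continuous_add := ?_
      continuous_const_mul := fun {A} => ?_
      continuous_mul_const := fun {A} => ?_ }
  · refine continuous_induced_rng.2 (continuous_pi fun p => ?_)
    have h : (fun q : (H →L[ℂ] H) × (H →L[ℂ] H) => normalFunctional p (q.1 + q.2))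
        = fun q => normalFunctional p q.1 + normalFunctional p q.2 :=
      funext fun q => normalFunctional_add p q.1 q.2
    have h' := weakStar_continuous_normalFunctional p
    exact h ▸ (h'.comp continuous_fst).add (h'.comp continuous_snd)
  · refine continuous_induced_rng.2 (continuous_pi fun p => ?_)
    have h := weakStar_continuous_normalFunctional
      (⟨(fun k => ContinuousLinearMap.adjoint A (p.1.1 k), p.1.2),
        summable_sq_map _ p.2.1, p.2.2⟩ : SqSummablePair H)
    refine h.congr fun T => ?_
    simp [normalFunctional, ContinuousLinearMap.adjoint_inner_left]
  · refine continuous_induced_rng.2 (continuous_pi fun p => ?_)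
    have h := weakStar_continuous_normalFunctional
      (⟨(p.1.1, fun k => A (p.1.2 k)), p.2.1, summable_sq_map _ p.2.2⟩ : SqSummablePair H)
    exact h.congr fun T => by simp [normalFunctional]

/-- The weak-star closure of an algebra of bounded operators. -/
def weakStarClosure [CompleteSpace H] (A : Subalgebra ℂ (H →L[ℂ] H)) :
    Subalgebra ℂ (H →L[ℂ] H) :=
  letI := weakStar H
  haveI := weakStar_isSemitopologicalSemiring (H := H)
  A.topologicalClosure

theorem topologicalClosure_le_weakStarClosure [CompleteSpace H]
    (A : Subalgebra ℂ (H →L[ℂ] H)) : A.topologicalClosure ≤ weakStarClosure A :=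
  fun _ hx => closure.mono norm_le_weakStar hx

end Ultraweak

/-! ### The Fock space and the creation operators -/

/-- Index set of the orthonormal basis of the Fock space: the pair
`([i₁, …, iₖ], [j₁, …, jₗ])` stands for `e_{i₁} ⊗ ⋯ ⊗ e_{iₖ} ⊗ f_{j₁} ⊗ ⋯ ⊗ f_{jₗ}`. -/
abbrev Word (n m : ℕ) : Type := List (Fin n) × List (Fin m)

/-- The Fock space `⨁_{k,l} (ℂⁿ)^{⊗k} ⊗ (ℂᵐ)^{⊗l}` (Hilbert space direct sum), written in its
standard orthonormal basis. -/
abbrev Fock (n m : ℕ) : Type := lp (fun _ : Word n m => ℂ) 2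

variable {n m : ℕ}

/-- The standard basis vector of the Fock space. -/
def basisVec (a : Word n m) : Fock n m := lp.single 2 a (1 : ℂ)

theorem orthonormal_basisVec : Orthonormal ℂ (basisVec : Word n m → Fock n m) := by
  classical
  rw [orthonormal_iff_ite]
  intro a b
  rw [basisVec, basisVec, lp.inner_single_left, lp.single_apply]
  by_cases h : a = b
  · subst h; simp
  · simp [h]

/-- The isometry of the Fock space that maps the standard basis to a given orthonormal family. -/
def isometryOf {v : Word n m → Fock n m} (hv : Orthonormal ℂ v) : Fock n m →ₗᵢ[ℂ] Fock n m :=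
  hv.orthogonalFamily.linearIsometry

theorem isometryOf_basisVec {v : Word n m → Fock n m} (hv : Orthonormal ℂ v) (a : Word n m) :
    isometryOf hv (basisVec a) = v a := by
  simp [isometryOf, basisVec]

theorem orthonormal_basisVec_cons (i : Fin n) :
    Orthonormal ℂ (fun a : Word n m => basisVec (i :: a.1, a.2)) :=
  orthonormal_basisVec.comp (fun a : Word n m => ((i :: a.1, a.2) : Word n m))
    (fun a b h => by simpa [Prod.ext_iff] using h)

/-- The creation operator `L_{e_i}`, on basis vectors `x ↦ e_i ⊗ x`. -/
def shiftE (i : Fin n) : Fock n m →ₗᵢ[ℂ] Fock n m := isometryOf (orthonormal_basisVec_cons i)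

theorem shiftE_basisVec (i : Fin n) (a : Word n m) :
    shiftE i (basisVec a) = basisVec (i :: a.1, a.2) :=
  isometryOf_basisVec _ a

/-- The vector `f_l ⊗ e_p ⊗ f_q`, for words `p` and `q`, as an element of the Fock space: it is
moved into standard form by repeated use of
`f_l ⊗ e_k = ∑_{i,j} conj u_{(i,j),(k,l)} e_i ⊗ f_j`. -/
def fTensor (u : Matrix.unitaryGroup (Fin n × Fin m) ℂ) (q : List (Fin m)) :
    Fin m → List (Fin n) → Fock n m
  | l, [] => basisVec ([], l :: q)
  | l, k :: p => ∑ ij : Fin n × Fin m,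
      (starRingEnd ℂ) (u.1 ij (k, l)) • shiftE ij.1 (fTensor u q ij.2 p)

theorem inner_basisVec_shiftE (q : List (Fin m)) (i : Fin n) (x : Fock n m) :
    inner ℂ (basisVec ([], q)) (shiftE i x) = 0 := by
  have h := (orthonormal_basisVec_cons (m := m) i).orthogonalFamily.hasSum_linearIsometry x
  have h2 := h.mapL (innerSL ℂ (basisVec (([], q) : Word n m)))
  refine h2.unique ?_
  convert hasSum_zero with a
  have h3 := orthonormal_basisVec.inner_eq_zero (𝕜 := ℂ)
    (show (([], q) : Word n m) ≠ (i :: a.1, a.2) by simp [Prod.ext_iff])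
  simp [h3]

theorem inner_shiftE_shiftE {i i' : Fin n} (h : i ≠ i') (x y : Fock n m) :
    inner ℂ (shiftE i x) (shiftE i' y) = 0 := by
  have hy := (orthonormal_basisVec_cons (m := m) i').orthogonalFamily.hasSum_linearIsometry y
  have hx := (orthonormal_basisVec_cons (m := m) i).orthogonalFamily.hasSum_linearIsometry x
  have key : ∀ a : Word n m, inner ℂ (shiftE i x) (basisVec (i' :: a.1, a.2)) = 0 := by
    intro a
    rw [← inner_conj_symm, map_eq_zero]
    have h2 := hx.mapL (innerSL ℂ (basisVec ((i' :: a.1, a.2) : Word n m)))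
    refine h2.unique ?_
    convert hasSum_zero with b
    have h3 := orthonormal_basisVec.inner_eq_zero (𝕜 := ℂ)
      (show ((i' :: a.1, a.2) : Word n m) ≠ (i :: b.1, b.2) by
        simp [Prod.ext_iff, Ne.symm h])
    simp [h3]
  have h2 := hy.mapL (innerSL ℂ (shiftE i x))
  refine h2.unique ?_
  convert hasSum_zero with a
  simp [key]

theorem inner_fTensor (u : Matrix.unitaryGroup (Fin n × Fin m) ℂ) (q q' : List (Fin m))
    (p : List (Fin n)) : ∀ (p' : List (Fin n)) (l l' : Fin m),
    inner ℂ (fTensor u q l p) (fTensor u q' l' p') =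
      if p = p' ∧ q = q' ∧ l = l' then (1 : ℂ) else 0 := by
  classical
  induction p with
  | nil =>
    intro p' l l'
    cases p' with
    | nil =>
      rw [fTensor, fTensor, orthonormal_iff_ite.mp orthonormal_basisVec]
      congr 1
      simp [and_comm]
    | cons k' p' =>
      simp [fTensor, inner_sum, inner_smul_right, inner_basisVec_shiftE]
  | cons k p ih =>
    intro p' l l'
    cases p' with
    | nil =>
      rw [← inner_conj_symm]
      simp [fTensor, inner_sum, inner_smul_right, inner_basisVec_shiftE]
    | cons k' p' =>
      have hin : ∀ a b : Fin n × Fin m,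
          inner ℂ (shiftE a.1 (fTensor u q a.2 p)) (shiftE b.1 (fTensor u q' b.2 p')) =
            if a = b then (if p = p' ∧ q = q' then (1 : ℂ) else 0) else 0 := by
        intro a b
        by_cases h : a.1 = b.1
        · rw [h, LinearIsometry.inner_map_map, ih]
          by_cases h2 : a.2 = b.2
          · simp [h2, Prod.ext_iff, h]
          · simp [h2, Prod.ext_iff]
        · rw [inner_shiftE_shiftE h]
          simp [Prod.ext_iff, h]
      have hu : ∑ a : Fin n × Fin m, (starRingEnd ℂ) (u.1 a (k', l')) * u.1 a (k, l) =
          if (k', l') = (k, l) then (1 : ℂ) else 0 := by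
        have h := congrFun (congrFun (Matrix.mem_unitaryGroup_iff'.mp u.2) (k', l')) (k, l)
        simpa [Matrix.mul_apply, Matrix.one_apply, Matrix.star_apply] using h
      simp only [fTensor, sum_inner, inner_sum, inner_smul_left, inner_smul_right, hin]
      simp only [mul_ite, mul_zero, Finset.sum_ite_eq', Finset.mem_univ, if_true]
      by_cases hpq : p = p' ∧ q = q'
      · obtain ⟨rfl, rfl⟩ := hpq
        simp only [and_self, if_true, mul_one, RingHomCompTriple.comp_apply, RingHom.id_apply]
        refine hu.trans ?_
        congr 1
        simp only [Prod.mk.injEq, List.cons.injEq, and_true, true_and, eq_iff_iff]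
        exact ⟨fun h => ⟨h.1.symm, h.2.symm⟩, fun h => ⟨h.1.symm, h.2.symm⟩⟩
      · rw [if_neg (fun h => hpq ⟨(List.cons.inj h.1).2, h.2.1⟩)]
        simp [hpq]

theorem orthonormal_fTensor (u : Matrix.unitaryGroup (Fin n × Fin m) ℂ) (l : Fin m) :
    Orthonormal ℂ (fun a : Word n m => fTensor u a.2 l a.1) := by
  classical
  rw [orthonormal_iff_ite]
  intro a b
  rw [inner_fTensor]
  congr 1
  simp [Prod.ext_iff]

/-- The creation operator `L_{f_l}`, on basis vectors `x ↦ f_l ⊗ x`. -/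
def shiftF (u : Matrix.unitaryGroup (Fin n × Fin m) ℂ) (l : Fin m) :
    Fock n m →ₗᵢ[ℂ] Fock n m :=
  isometryOf (orthonormal_fTensor u l)

/-- The creation operator `L_e` of a vector `e ∈ ℂⁿ`. -/
def opE (e : EuclideanSpace ℂ (Fin n)) : Fock n m →L[ℂ] Fock n m :=
  ∑ i, e i • (shiftE i).toContinuousLinearMap

/-- The creation operator `L_f` of a vector `f ∈ ℂᵐ`. -/
def opF (u : Matrix.unitaryGroup (Fin n × Fin m) ℂ) (f : EuclideanSpace ℂ (Fin m)) :
    Fock n m →L[ℂ] Fock n m :=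
  ∑ j, f j • (shiftF u j).toContinuousLinearMap

/-! ### The algebras -/

/-- The unital semigroup `𝔽_u⁺` generated by the creation operators. -/
def semigroup (u : Matrix.unitaryGroup (Fin n × Fin m) ℂ) :
    Submonoid (Fock n m →L[ℂ] Fock n m) :=
  Submonoid.closure (Set.range opE ∪ Set.range (opF u))

/-- The algebra `ℂ[𝔽_u⁺]` generated by the semigroup. -/
def polyAlg (u : Matrix.unitaryGroup (Fin n × Fin m) ℂ) :
    Subalgebra ℂ (Fock n m →L[ℂ] Fock n m) :=
  Algebra.adjoin ℂ (semigroup u : Set (Fock n m →L[ℂ] Fock n m))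

/-- The norm closure `𝒜_u` of `ℂ[𝔽_u⁺]`. -/
def normAlg (u : Matrix.unitaryGroup (Fin n × Fin m) ℂ) :
    Subalgebra ℂ (Fock n m →L[ℂ] Fock n m) :=
  (polyAlg u).topologicalClosure

/-- The weak-star closure `ℒ_u` of `ℂ[𝔽_u⁺]`. -/
def weakAlg (u : Matrix.unitaryGroup (Fin n × Fin m) ℂ) :
    Subalgebra ℂ (Fock n m →L[ℂ] Fock n m) :=
  weakStarClosure (polyAlg u)

theorem polyAlg_le_normAlg (u : Matrix.unitaryGroup (Fin n × Fin m) ℂ) :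
    polyAlg u ≤ normAlg u :=
  Subalgebra.le_topologicalClosure _

theorem normAlg_le_weakAlg (u : Matrix.unitaryGroup (Fin n × Fin m) ℂ) :
    normAlg u ≤ weakAlg u :=
  topologicalClosure_le_weakStarClosure _

/-- The generator `L_{e_i}` as an element of `ℂ[𝔽_u⁺]`. -/
def genE (u : Matrix.unitaryGroup (Fin n × Fin m) ℂ) (i : Fin n) : polyAlg u :=
  ⟨opE (EuclideanSpace.single i 1),
    Algebra.subset_adjoin (Submonoid.subset_closure (Or.inl ⟨_, rfl⟩))⟩

/-- The generator `L_{f_j}` as an element of `ℂ[𝔽_u⁺]`. -/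
def genF (u : Matrix.unitaryGroup (Fin n × Fin m) ℂ) (j : Fin m) : polyAlg u :=
  ⟨opF u (EuclideanSpace.single j 1),
    Algebra.subset_adjoin (Submonoid.subset_closure (Or.inr ⟨_, rfl⟩))⟩

/-! ### Points and characters -/

/-- The variety `V_u` in `ℂⁿ × ℂᵐ`. -/
def variety (u : Matrix.unitaryGroup (Fin n × Fin m) ℂ) :
    Set (EuclideanSpace ℂ (Fin n) × EuclideanSpace ℂ (Fin m)) :=
  {p | ∀ i j, p.1 i * p.2 j = ∑ kl : Fin n × Fin m, u.1 (i, j) kl * (p.1 kl.1 * p.2 kl.2)}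

/-- `Ω_u`, the part of `V_u` in the product of the closed Euclidean unit balls. -/
def omega (u : Matrix.unitaryGroup (Fin n × Fin m) ℂ) :
    Set (EuclideanSpace ℂ (Fin n) × EuclideanSpace ℂ (Fin m)) :=
  variety u ∩ Metric.closedBall 0 1 ×ˢ Metric.closedBall 0 1

/-- The point `((φ(L_{e_i}))ᵢ, (φ(L_{f_j}))ⱼ)` of a functional `φ` on `ℂ[𝔽_u⁺]`. -/
def pointOf (u : Matrix.unitaryGroup (Fin n × Fin m) ℂ) (φ : polyAlg u → ℂ) :
    EuclideanSpace ℂ (Fin n) × EuclideanSpace ℂ (Fin m) :=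
  (WithLp.toLp 2 fun i => φ (genE u i), WithLp.toLp 2 fun j => φ (genF u j))

/-- The multiplicative linear functionals on `ℂ[𝔽_u⁺]` (nonzero, as always for characters). -/
def polyCharacters (u : Matrix.unitaryGroup (Fin n × Fin m) ℂ) : Set (polyAlg u →ₗ[ℂ] ℂ) :=
  {φ | φ ≠ 0 ∧ ∀ x y, φ (x * y) = φ x * φ y}

/-- The character `φ` of `𝒜_u` is the restriction of a weak-star continuous character of `ℒ_u`. -/
def ExtendsWeakStar (u : Matrix.unitaryGroup (Fin n × Fin m) ℂ)
    (φ : WeakDual.characterSpace ℂ (normAlg u)) : Prop :=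
  ∃ ψ : weakAlg u →ₗ[ℂ] ℂ, ψ ≠ 0 ∧ (∀ x y, ψ (x * y) = ψ x * ψ y) ∧
    @Continuous (weakAlg u) ℂ
      (TopologicalSpace.induced Subtype.val (weakStar (Fock n m))) _ ψ ∧
    ∀ x : normAlg u, ψ (Subalgebra.inclusion (normAlg_le_weakAlg u) x) = φ x

end UnitaryRelation

end

noncomputable section

namespace UnitaryRelation

open Filter Topology

variable {n m : ℕ}

/-! ### The standard basis of the Fock space -/

/-! Everything rests on one functional: evaluation of words at a point `p = (z, w)`, sending a basis
vector to the corresponding monomial in `z` and `w`. Multiplying on the left by `e_i` multiplies its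
value by `z_i`. Multiplying by `f_l` multiplies it by `w_l` exactly because `p` lies on the variety,
so that rewriting `f ⊗ e` as a combination of `e ⊗ f` does not change the value. Evaluation is thus
an eigenvector of the transpose of every `T` in the algebra, and its eigenvalue is a character
(`polyAlg_le_evalSubalgebra`). Conversely, the commutation relation `genE_mul_genF` puts the point
of any character on the variety, and the point determines the character because the generators
generate.

When `p` is in the open balls, evaluation is the inner product with a vector `ν` of the Fock space
(`kernelVec`). Then `⟨ν, T ν⟩ = χ(T) ‖ν‖²` makes the character contractive; the closed balls follow
by scaling, since the variety is a cone. In the other direction, a character of `𝒜_u` is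
contractive, and `L_e` with `e` the conjugate of `z` has norm at most `‖z‖` but value `‖z‖²`; hence
`‖z‖ ≤ 1`, and likewise for `w`. Compactness turns the continuous bijection into a homeomorphism.

For open balls, `T ↦ ⟨ν, T vacuum⟩` is the weak-star continuous extension. If `‖z‖ = 1`, the same
`L_e` is a contraction with value `1`, while its powers raise the degree and tend weak-star to `0`;
no extension can be continuous. The case `‖w‖ = 1` is the same. -/

theorem hasSum_basisVec (x : Fock n m) : HasSum (fun a => x a • basisVec a) x := by
  have h := lp.hasSum_single (p := 2) (by simp) x
  refine h.congr_fun fun a => ?_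
  rw [basisVec, ← lp.single_smul, smul_eq_mul, mul_one]

theorem dense_span_basisVec :
    Dense (Submodule.span ℂ (Set.range (basisVec : Word n m → Fock n m)) : Set (Fock n m)) := by
  intro x
  refine mem_closure_of_tendsto (hasSum_basisVec x) (Eventually.of_forall fun s => ?_)
  exact Submodule.sum_mem _ fun a _ =>
    Submodule.smul_mem _ _ (Submodule.subset_span ⟨a, rfl⟩)

theorem clm_ext_basisVec {G : Type*} [TopologicalSpace G] [AddCommMonoid G] [Module ℂ G]
    [T2Space G] {S T : Fock n m →L[ℂ] G} (h : ∀ a, S (basisVec a) = T (basisVec a)) : S = T :=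
  ContinuousLinearMap.ext_on dense_span_basisVec (by rintro _ ⟨a, rfl⟩; exact h a)

theorem inner_basisVec (a : Word n m) (x : Fock n m) : inner ℂ (basisVec a) x = x a := by
  rw [basisVec, lp.inner_single_left]
  simp

theorem shiftF_basisVec (u : Matrix.unitaryGroup (Fin n × Fin m) ℂ) (l : Fin m) (a : Word n m) :
    shiftF u l (basisVec a) = fTensor u a.2 l a.1 :=
  isometryOf_basisVec _ a

theorem inner_isometry_eq_zero (V W : Fock n m →ₗᵢ[ℂ] Fock n m)
    (h : ∀ a b, inner ℂ (V (basisVec a)) (W (basisVec b)) = 0) (x y : Fock n m) :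
    inner ℂ (V x) (W y) = 0 := by
  have key : ∀ b x, inner ℂ (W (basisVec b)) (V x) = 0 := by
    intro b x
    have h0 : (innerSL ℂ (W (basisVec b))).comp V.toContinuousLinearMap = 0 := by
      refine clm_ext_basisVec fun a => ?_
      have := inner_eq_zero_symm.mp (h a b)
      simpa using this
    simpa using DFunLike.congr_fun h0 x
  have h1 : (innerSL ℂ (V x)).comp W.toContinuousLinearMap = 0 :=
    clm_ext_basisVec fun b => by
      have := inner_eq_zero_symm.mp (key b x)
      simpa using this
  simpa using DFunLike.congr_fun h1 y

theorem inner_shiftF_shiftF (u : Matrix.unitaryGroup (Fin n × Fin m) ℂ) {l l' : Fin m}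
    (h : l ≠ l') (x y : Fock n m) : inner ℂ (shiftF u l x) (shiftF u l' y) = 0 := by
  refine inner_isometry_eq_zero _ _ (fun a b => ?_) x y
  rw [shiftF_basisVec, shiftF_basisVec, inner_fTensor, if_neg (fun H => h H.2.2)]

/-- Pythagoras: the ranges are mutually orthogonal, so `‖∑ cᵢ Vᵢ x‖² = ∑ |cᵢ|² ‖x‖²`. The Euclidean
norm of the coefficients is what makes the unit balls appear. -/
theorem norm_sum_smul_isometry_le {ι H : Type*} [Fintype ι] [NormedAddCommGroup H]
    [InnerProductSpace ℂ H] (V : ι → H →ₗᵢ[ℂ] H)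
    (h : ∀ i j, i ≠ j → ∀ x y, inner ℂ (V i x) (V j y) = 0) (c : EuclideanSpace ℂ ι) :
    ‖∑ i, c i • (V i).toContinuousLinearMap‖ ≤ ‖c‖ := by
  have hV : OrthogonalFamily ℂ (fun _ : ι => H) V := fun i j hij x y => h i j hij x y
  refine ContinuousLinearMap.opNorm_le_bound _ (norm_nonneg _) fun x => ?_
  refine (sq_le_sq₀ (norm_nonneg _) (by positivity)).mp ?_
  have h1 := hV.norm_sum (fun i => c i • x) Finset.univ
  have h2 : (∑ i, c i • (V i).toContinuousLinearMap) x = ∑ i, V i (c i • x) := by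
    simp
  rw [h2, h1, mul_pow, EuclideanSpace.norm_sq_eq, Finset.sum_mul]
  simp [norm_smul, mul_pow]

theorem norm_opE_le (e : EuclideanSpace ℂ (Fin n)) :
    ‖(opE e : Fock n m →L[ℂ] Fock n m)‖ ≤ ‖e‖ :=
  norm_sum_smul_isometry_le _ (fun _ _ h => inner_shiftE_shiftE h) e

theorem norm_opF_le (u : Matrix.unitaryGroup (Fin n × Fin m) ℂ) (f : EuclideanSpace ℂ (Fin m)) :
    ‖opF u f‖ ≤ ‖f‖ :=
  norm_sum_smul_isometry_le _ (fun _ _ h => inner_shiftF_shiftF u h) f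

/-! ### The generators -/

theorem opE_single (i : Fin n) :
    (opE (EuclideanSpace.single i 1) : Fock n m →L[ℂ] Fock n m)
      = (shiftE i).toContinuousLinearMap := by
  simp [opE]

theorem opF_single (u : Matrix.unitaryGroup (Fin n × Fin m) ℂ) (j : Fin m) :
    opF u (EuclideanSpace.single j 1) = (shiftF u j).toContinuousLinearMap := by
  simp [opF]

variable {u : Matrix.unitaryGroup (Fin n × Fin m) ℂ}

theorem genE_apply (i : Fin n) (x : Fock n m) : (genE u i).1 x = shiftE i x := by
  simp [genE, opE_single]

theorem genF_apply (j : Fin m) (x : Fock n m) : (genF u j).1 x = shiftF u j x := by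
  simp [genF, opF_single]

theorem opE_mem (u : Matrix.unitaryGroup (Fin n × Fin m) ℂ) (e : EuclideanSpace ℂ (Fin n)) :
    opE e ∈ polyAlg u :=
  Algebra.subset_adjoin (Submonoid.subset_closure (Or.inl ⟨_, rfl⟩))

theorem opF_mem (u : Matrix.unitaryGroup (Fin n × Fin m) ℂ) (f : EuclideanSpace ℂ (Fin m)) :
    opF u f ∈ polyAlg u :=
  Algebra.subset_adjoin (Submonoid.subset_closure (Or.inr ⟨_, rfl⟩))

theorem opE_eq_sum (e : EuclideanSpace ℂ (Fin n)) :
    (⟨opE e, opE_mem u e⟩ : polyAlg u) = ∑ i, e i • genE u i := by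
  apply Subtype.ext
  simp [genE, opE]

theorem opF_eq_sum (f : EuclideanSpace ℂ (Fin m)) :
    (⟨opF u f, opF_mem u f⟩ : polyAlg u) = ∑ j, f j • genF u j := by
  apply Subtype.ext
  simp [genF, opF]

/-- A subalgebra of `ℂ[𝔽_u⁺]` that contains the generators is everything. -/
theorem mem_of_gen_mem {S : Subalgebra ℂ (polyAlg u)} (hE : ∀ i, genE u i ∈ S)
    (hF : ∀ j, genF u j ∈ S) (T : polyAlg u) : T ∈ S := by
  have h : polyAlg u ≤ S.map (polyAlg u).val := by
    refine Algebra.adjoin_le ?_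
    change semigroup u ≤ (S.map (polyAlg u).val).toSubmonoid
    refine Submonoid.closure_le.mpr ?_
    rintro _ (⟨e, rfl⟩ | ⟨f, rfl⟩)
    · refine ⟨⟨opE e, opE_mem u e⟩, ?_, rfl⟩
      rw [opE_eq_sum]
      exact S.sum_mem fun i _ => S.smul_mem (hE i) _
    · refine ⟨⟨opF u f, opF_mem u f⟩, ?_, rfl⟩
      rw [opF_eq_sum]
      exact S.sum_mem fun j _ => S.smul_mem (hF j) _
  obtain ⟨T', hT', h'⟩ := h T.2
  rwa [← Subtype.ext h']

theorem polyAlg_algHom_ext {φ ψ : polyAlg u →ₐ[ℂ] ℂ} (hE : ∀ i, φ (genE u i) = ψ (genE u i))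
    (hF : ∀ j, φ (genF u j) = ψ (genF u j)) : φ = ψ :=
  AlgHom.ext fun T => mem_of_gen_mem (S := AlgHom.equalizer φ ψ) hE hF T

theorem sum_mul_conj (u : Matrix.unitaryGroup (Fin n × Fin m) ℂ) (a b : Fin n × Fin m) :
    ∑ c, u.1 a c * (starRingEnd ℂ) (u.1 b c) = if a = b then 1 else 0 := by
  have h := congrFun (congrFun (Matrix.mem_unitaryGroup_iff.mp u.2) a) b
  simpa [Matrix.mul_apply, Matrix.one_apply, Matrix.star_apply] using h

theorem sum_conj_mul (u : Matrix.unitaryGroup (Fin n × Fin m) ℂ) (a b : Fin n × Fin m) :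
    ∑ c, (starRingEnd ℂ) (u.1 c a) * u.1 c b = if a = b then 1 else 0 := by
  have h := congrFun (congrFun (Matrix.mem_unitaryGroup_iff'.mp u.2) a) b
  simpa [Matrix.mul_apply, Matrix.one_apply, Matrix.star_apply] using h

/-- The commutation relation between the two families of creation operators. -/
theorem genE_mul_genF (i : Fin n) (j : Fin m) :
    genE u i * genF u j = ∑ kl : Fin n × Fin m, u.1 (i, j) kl • (genF u kl.2 * genE u kl.1) := by
  apply Subtype.ext
  refine clm_ext_basisVec fun a => ?_
  have hL : (genE u i * genF u j).1 (basisVec a) = shiftE i (fTensor u a.2 j a.1) := by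
    simp [genE_apply, genF_apply, shiftF_basisVec]
  -- The defining recursion of `fTensor` on a nonempty `e`-word is the relation for `f_l ⊗ e_k`;
  -- substituting it here leaves the orthonormality of the rows of `u`.
  have hR : ∀ kl : Fin n × Fin m, (genF u kl.2 * genE u kl.1).1 (basisVec a) =
      ∑ c : Fin n × Fin m, (starRingEnd ℂ) (u.1 c kl) • shiftE c.1 (fTensor u a.2 c.2 a.1) := by
    intro kl
    simp [genE_apply, genF_apply, shiftE_basisVec, shiftF_basisVec, fTensor]
  rw [hL]
  have hR' : (∑ kl : Fin n × Fin m, u.1 (i, j) kl • (genF u kl.2 * genE u kl.1)).1 (basisVec a)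
      = ∑ kl : Fin n × Fin m, u.1 (i, j) kl • (genF u kl.2 * genE u kl.1).1 (basisVec a) := by
    simp
  rw [hR']
  simp only [hR, Finset.smul_sum, smul_smul]
  rw [Finset.sum_comm]
  simp only [← Finset.sum_smul, sum_mul_conj]
  simp

/-! ### Evaluation at a point of the variety -/

/-- The monomial of a word, evaluated at a point. -/
def evalWord (p : EuclideanSpace ℂ (Fin n) × EuclideanSpace ℂ (Fin m)) (a : Word n m) : ℂ :=
  (a.1.map fun i => p.1 i).prod * (a.2.map fun j => p.2 j).prod

/-- For a point outside the open balls evaluation need not be bounded, so it is defined on the span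
of the basis and extended algebraically. Only its values on finite vectors are ever used. -/
theorem exists_evalLinear (p : EuclideanSpace ℂ (Fin n) × EuclideanSpace ℂ (Fin m)) :
    ∃ Λ : Fock n m →ₗ[ℂ] ℂ, ∀ a, Λ (basisVec a) = evalWord p a := by
  have hli := (orthonormal_basisVec (n := n) (m := m)).linearIndependent
  obtain ⟨Λ, hΛ⟩ := LinearMap.exists_extend ((Module.Basis.span hli).constr ℂ (evalWord p))
  refine ⟨Λ, fun a => ?_⟩
  have h := (Module.Basis.span hli).constr_basis ℂ (evalWord p) a
  rw [← hΛ] at h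
  simpa [Module.Basis.span_apply] using h

/-- A linear functional on the Fock space with `basisVec a ↦ evalWord p a`. -/
def evalLinear (p : EuclideanSpace ℂ (Fin n) × EuclideanSpace ℂ (Fin m)) :
    Fock n m →ₗ[ℂ] ℂ := (exists_evalLinear p).choose

theorem evalLinear_basisVec (p : EuclideanSpace ℂ (Fin n) × EuclideanSpace ℂ (Fin m))
    (a : Word n m) : evalLinear p (basisVec a) = evalWord p a := (exists_evalLinear p).choose_spec a

variable (n m) in
/-- The vectors with finitely many nonzero coordinates. -/
def finiteVectors : Submodule ℂ (Fock n m) :=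
  Submodule.span ℂ (Set.range (basisVec : Word n m → Fock n m))

theorem basisVec_mem (a : Word n m) : basisVec a ∈ finiteVectors n m :=
  Submodule.subset_span ⟨a, rfl⟩

/-- Invariance of the finite vectors is carried along with the eigenvalue relation, because
evaluation is under control only on that subspace. -/
theorem shiftE_eval (p : EuclideanSpace ℂ (Fin n) × EuclideanSpace ℂ (Fin m)) (i : Fin n)
    {x : Fock n m} (hx : x ∈ finiteVectors n m) :
    shiftE i x ∈ finiteVectors n m ∧ evalLinear p (shiftE i x) = p.1 i * evalLinear p x := by
  induction hx using Submodule.span_induction with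
  | mem x hx =>
    obtain ⟨a, rfl⟩ := hx
    rw [shiftE_basisVec, evalLinear_basisVec, evalLinear_basisVec]
    exact ⟨basisVec_mem _, by simp [evalWord, mul_assoc]⟩
  | zero => simp
  | add x y _ _ hx hy =>
    rw [map_add, map_add, map_add, hx.2, hy.2, mul_add]
    exact ⟨Submodule.add_mem _ hx.1 hy.1, rfl⟩
  | smul c x _ hx =>
    rw [map_smul, map_smul, map_smul, hx.2, smul_eq_mul, smul_eq_mul, mul_left_comm]
    exact ⟨Submodule.smul_mem _ _ hx.1, rfl⟩

/-- The variety condition says that `u` fixes the vector `(z_k w_l)`; hence so does a form of the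
inverse, by orthonormality of the columns. -/
theorem sum_conj_mul_of_mem_variety
    {p : EuclideanSpace ℂ (Fin n) × EuclideanSpace ℂ (Fin m)} (hp : p ∈ variety u)
    (k : Fin n) (l : Fin m) :
    ∑ c : Fin n × Fin m, (starRingEnd ℂ) (u.1 c (k, l)) * (p.1 c.1 * p.2 c.2)
      = p.1 k * p.2 l := by
  have h : ∀ c : Fin n × Fin m, (starRingEnd ℂ) (u.1 c (k, l)) * (p.1 c.1 * p.2 c.2) =
      ∑ d : Fin n × Fin m,
        (starRingEnd ℂ) (u.1 c (k, l)) * u.1 c d * (p.1 d.1 * p.2 d.2) := by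
    intro c
    rw [hp c.1 c.2, Finset.mul_sum]
    simp only [mul_assoc]
  simp only [h]
  rw [Finset.sum_comm]
  simp only [← Finset.sum_mul, sum_conj_mul]
  simp

/-- Induction on the `e`-word: each exchange of `f` with one letter `e` preserves the value because
the point is on the variety. -/
theorem fTensor_eval {p : EuclideanSpace ℂ (Fin n) × EuclideanSpace ℂ (Fin m)}
    (hp : p ∈ variety u) (q : List (Fin m)) (r : List (Fin n)) : ∀ l : Fin m,
    fTensor u q l r ∈ finiteVectors n m ∧
      evalLinear p (fTensor u q l r) = p.2 l * evalWord p (r, q) := by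
  induction r with
  | nil =>
    intro l
    rw [fTensor, evalLinear_basisVec]
    exact ⟨basisVec_mem _, by simp [evalWord]⟩
  | cons k r ih =>
    intro l
    rw [fTensor]
    refine ⟨Submodule.sum_mem _ fun c _ =>
      Submodule.smul_mem _ _ (shiftE_eval p _ (ih c.2).1).1, ?_⟩
    have h : ∀ c : Fin n × Fin m, evalLinear p (shiftE c.1 (fTensor u q c.2 r)) =
        p.1 c.1 * p.2 c.2 * evalWord p (r, q) := fun c => by
      rw [(shiftE_eval p _ (ih c.2).1).2, (ih c.2).2, mul_assoc]
    simp only [map_sum, map_smul, h, smul_eq_mul]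
    have h' := congrArg (· * evalWord p (r, q)) (sum_conj_mul_of_mem_variety hp k l)
    simp only [Finset.sum_mul, mul_assoc] at h' ⊢
    rw [h']
    simp only [evalWord, List.map_cons, List.prod_cons]
    ring

theorem shiftF_eval {p : EuclideanSpace ℂ (Fin n) × EuclideanSpace ℂ (Fin m)}
    (hp : p ∈ variety u) (l : Fin m) {x : Fock n m} (hx : x ∈ finiteVectors n m) :
    shiftF u l x ∈ finiteVectors n m ∧ evalLinear p (shiftF u l x) = p.2 l * evalLinear p x := by
  induction hx using Submodule.span_induction with
  | mem x hx =>
    obtain ⟨a, rfl⟩ := hx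
    rw [shiftF_basisVec, evalLinear_basisVec]
    exact fTensor_eval hp _ _ l
  | zero => simp
  | add x y _ _ hx hy =>
    rw [map_add, map_add, map_add, hx.2, hy.2, mul_add]
    exact ⟨Submodule.add_mem _ hx.1 hy.1, rfl⟩
  | smul c x _ hx =>
    rw [map_smul, map_smul, map_smul, hx.2, smul_eq_mul, smul_eq_mul, mul_left_comm]
    exact ⟨Submodule.smul_mem _ _ hx.1, rfl⟩

/-- The vacuum vector. -/
def vacuum : Fock n m := basisVec ([], [])

theorem vacuum_mem : (vacuum : Fock n m) ∈ finiteVectors n m := basisVec_mem _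

theorem evalLinear_vacuum (p : EuclideanSpace ℂ (Fin n) × EuclideanSpace ℂ (Fin m)) :
    evalLinear p vacuum = 1 := by
  simp [vacuum, evalLinear_basisVec, evalWord]

/-- The operators that preserve the finite vectors and for which the evaluation at `p` is an
eigenvector of the transpose. -/
def evalSubalgebra (p : EuclideanSpace ℂ (Fin n) × EuclideanSpace ℂ (Fin m)) :
    Subalgebra ℂ (Fock n m →L[ℂ] Fock n m) where
  -- Evaluation is `1` at the vacuum, so the eigenvalue can only be the value at `T vacuum`. Writing
  -- it so makes multiplicativity a matter of composing eigenvalue relations.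
  carrier := {T | ∀ x ∈ finiteVectors n m, T x ∈ finiteVectors n m ∧
    evalLinear p (T x) = evalLinear p (T vacuum) * evalLinear p x}
  mul_mem' := by
    intro S T hS hT x hx
    have h1 := hT x hx
    have h2 := hS _ h1.1
    have h3 := hS _ (hT _ vacuum_mem).1
    refine ⟨h2.1, ?_⟩
    simp only [mul_apply_eq_comp]
    rw [h2.2, h1.2, h3.2, mul_assoc]
  add_mem' := by
    intro S T hS hT x hx
    refine ⟨Submodule.add_mem _ (hS x hx).1 (hT x hx).1, ?_⟩
    simp only [add_apply, map_add]
    rw [(hS x hx).2, (hT x hx).2, add_mul]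
  algebraMap_mem' := by
    intro c x hx
    rw [Algebra.algebraMap_eq_smul_one]
    refine ⟨Submodule.smul_mem _ _ hx, ?_⟩
    simp [evalLinear_vacuum]

theorem polyAlg_le_evalSubalgebra {p : EuclideanSpace ℂ (Fin n) × EuclideanSpace ℂ (Fin m)}
    (hp : p ∈ variety u) : polyAlg u ≤ evalSubalgebra p := by
  intro T hT
  refine mem_of_gen_mem (S := (evalSubalgebra p).comap (polyAlg u).val) ?_ ?_ ⟨T, hT⟩
  · intro i x hx
    have h : (genE u i).1 = (shiftE i).toContinuousLinearMap := opE_single i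
    change (genE u i).1 x ∈ _ ∧ evalLinear p ((genE u i).1 x) =
      evalLinear p ((genE u i).1 vacuum) * _
    rw [h]
    refine ⟨(shiftE_eval p i hx).1, ?_⟩
    simp [(shiftE_eval p i hx).2, (shiftE_eval p i vacuum_mem).2, evalLinear_vacuum]
  · intro j x hx
    have h : (genF u j).1 = (shiftF u j).toContinuousLinearMap := opF_single u j
    change (genF u j).1 x ∈ _ ∧ evalLinear p ((genF u j).1 x) =
      evalLinear p ((genF u j).1 vacuum) * _
    rw [h]
    refine ⟨(shiftF_eval hp j hx).1, ?_⟩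
    simp [(shiftF_eval hp j hx).2, (shiftF_eval hp j vacuum_mem).2, evalLinear_vacuum]

/-- The character of `ℂ[𝔽_u⁺]` at a point of the variety. -/
def polyChar (p : variety u) : polyAlg u →ₐ[ℂ] ℂ :=
  AlgHom.ofLinearMap
    { toFun := fun T => evalLinear p.1 (T.1 vacuum)
      map_add' := fun S T => by simp
      map_smul' := fun c T => by simp }
    (by simp [evalLinear_vacuum])
    (fun S T => by
      have h := (polyAlg_le_evalSubalgebra p.2 S.2 _
        (polyAlg_le_evalSubalgebra p.2 T.2 _ vacuum_mem).1).2
      simpa using h)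

theorem polyChar_eval (p : variety u) (T : polyAlg u) {x : Fock n m}
    (hx : x ∈ finiteVectors n m) :
    evalLinear p.1 (T.1 x) = polyChar p T * evalLinear p.1 x :=
  (polyAlg_le_evalSubalgebra p.2 T.2 x hx).2

theorem polyChar_genE (p : variety u) (i : Fin n) : polyChar p (genE u i) = p.1.1 i := by
  change evalLinear p.1 ((genE u i).1 vacuum) = _
  rw [genE_apply, (shiftE_eval p.1 i vacuum_mem).2, evalLinear_vacuum, mul_one]

theorem polyChar_genF (p : variety u) (j : Fin m) : polyChar p (genF u j) = p.1.2 j := by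
  change evalLinear p.1 ((genF u j).1 vacuum) = _
  rw [genF_apply, (shiftF_eval p.2 j vacuum_mem).2, evalLinear_vacuum, mul_one]

theorem pointOf_polyChar (p : variety u) : pointOf u (polyChar p) = p.1 := by
  refine Prod.ext ?_ ?_
  · ext i; simp [pointOf, polyChar_genE]
  · ext j; simp [pointOf, polyChar_genF]

theorem pointOf_mem_variety (φ : polyAlg u →ₐ[ℂ] ℂ) : pointOf u φ ∈ variety u := by
  intro i j
  have h := congrArg φ (genE_mul_genF (u := u) i j)
  simp only [map_mul, map_sum, AlgHom.map_smul_of_tower, smul_eq_mul] at h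
  simp only [pointOf]
  rw [h]
  exact Finset.sum_congr rfl fun c _ => by rw [mul_comm (φ (genF u c.2))]

theorem pointOf_injective {φ ψ : polyAlg u →ₐ[ℂ] ℂ} (h : pointOf u φ = pointOf u ψ) : φ = ψ := by
  refine polyAlg_algHom_ext (fun i => ?_) fun j => ?_
  · exact congrArg (fun q : EuclideanSpace ℂ (Fin n) × EuclideanSpace ℂ (Fin m) => q.1 i) h
  · exact congrArg (fun q : EuclideanSpace ℂ (Fin n) × EuclideanSpace ℂ (Fin m) => q.2 j) h

theorem exists_algHom_of_mem_polyCharacters {φ : polyAlg u →ₗ[ℂ] ℂ} (hφ : φ ∈ polyCharacters u) :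
    ∃ ψ : polyAlg u →ₐ[ℂ] ℂ, ψ.toLinearMap = φ := by
  have h1 : φ 1 = 1 := by
    by_contra hne
    refine hφ.1 (LinearMap.ext fun x => ?_)
    have h := hφ.2 x 1
    rw [mul_one] at h
    have h' : φ x * (φ 1 - 1) = 0 := by rw [mul_sub, ← h, mul_one, sub_self]
    exact (mul_eq_zero.mp h').resolve_right (sub_ne_zero.mpr hne)
  exact ⟨AlgHom.ofLinearMap φ h1 hφ.2, rfl⟩

theorem bijOn_polyCharacters (u : Matrix.unitaryGroup (Fin n × Fin m) ℂ) :
    Set.BijOn (fun φ : polyAlg u →ₗ[ℂ] ℂ => pointOf u φ) (polyCharacters u) (variety u) := by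
  refine ⟨fun φ hφ => ?_, fun φ hφ ψ hψ h => ?_, fun p hp => ?_⟩
  · obtain ⟨φ, rfl⟩ := exists_algHom_of_mem_polyCharacters hφ
    exact pointOf_mem_variety φ
  · obtain ⟨φ, rfl⟩ := exists_algHom_of_mem_polyCharacters hφ
    obtain ⟨ψ, rfl⟩ := exists_algHom_of_mem_polyCharacters hψ
    rw [pointOf_injective h]
  · refine ⟨(polyChar ⟨p, hp⟩).toLinearMap, ⟨fun h => ?_, fun x y => map_mul (polyChar ⟨p, hp⟩) x y⟩,
      pointOf_polyChar ⟨p, hp⟩⟩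
    have h1 := DFunLike.congr_fun h (1 : polyAlg u)
    simp at h1

/-! ### The kernel vectors of the points of the open balls -/

/-- The words of length `k` contribute `(∑ c i) ^ k`, so the sum over all words is a geometric
series. -/
theorem summable_list_prod {ι : Type*} [Fintype ι] {c : ι → ℝ} (hc : ∀ i, 0 ≤ c i)
    (h : ∑ i, c i < 1) : Summable fun l : List ι => (l.map c).prod := by
  rw [← List.equivSigmaTuple.symm.summable_iff]
  have hprod : ∀ x : (k : ℕ) × (Fin k → ι),
      ((fun l : List ι => (l.map c).prod) ∘ List.equivSigmaTuple.symm) x = ∏ i, c (x.2 i) := by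
    intro x
    simp [List.equivSigmaTuple, List.prod_ofFn]
  rw [summable_sigma_of_nonneg]
  · refine ⟨fun k => Summable.of_finite, ?_⟩
    simp only [hprod, tsum_fintype, ← Fintype.sum_pow]
    exact summable_geometric_of_lt_one (Finset.sum_nonneg fun i _ => hc i) h
  · intro x
    rw [hprod]
    exact Finset.prod_nonneg fun i _ => hc _

theorem list_prod_norm_sq {ι : Type*} (c : ι → ℂ) (l : List ι) :
    ‖(l.map c).prod‖ ^ 2 = (l.map fun i => ‖c i‖ ^ 2).prod := by
  induction l with
  | nil => simp
  | cons i l ih => simp [mul_pow, ih]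

theorem sum_norm_sq_lt_one {ι : Type*} [Fintype ι] {z : EuclideanSpace ℂ ι} (hz : ‖z‖ < 1) :
    ∑ i, ‖z i‖ ^ 2 < 1 := by
  rw [← EuclideanSpace.norm_sq_eq]
  exact pow_lt_one₀ (norm_nonneg _) hz two_ne_zero

theorem memℓp_evalWord {p : EuclideanSpace ℂ (Fin n) × EuclideanSpace ℂ (Fin m)}
    (h1 : ‖p.1‖ < 1) (h2 : ‖p.2‖ < 1) :
    Memℓp (fun a : Word n m => (starRingEnd ℂ) (evalWord p a)) 2 := by
  rw [memℓp_gen_iff (by norm_num)]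
  have h := (summable_list_prod (fun i => by positivity) (sum_norm_sq_lt_one h1)).mul_of_nonneg
    (summable_list_prod (fun i => by positivity) (sum_norm_sq_lt_one h2))
    (fun l => (sq_nonneg _).trans_eq (list_prod_norm_sq _ l))
    (fun l => (sq_nonneg _).trans_eq (list_prod_norm_sq _ l))
  refine h.congr fun a => ?_
  rw [← list_prod_norm_sq, ← list_prod_norm_sq]
  simp [evalWord, mul_pow]

/-- The kernel vector of a point of the open balls; its inner product is evaluation at `p`. -/
def kernelVec (p : EuclideanSpace ℂ (Fin n) × EuclideanSpace ℂ (Fin m))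
    (h1 : ‖p.1‖ < 1) (h2 : ‖p.2‖ < 1) : Fock n m :=
  ⟨fun a => (starRingEnd ℂ) (evalWord p a), memℓp_evalWord h1 h2⟩

section kernelVec

variable {p : EuclideanSpace ℂ (Fin n) × EuclideanSpace ℂ (Fin m)}
  (h1 : ‖p.1‖ < 1) (h2 : ‖p.2‖ < 1)

theorem inner_kernelVec_basisVec (a : Word n m) :
    inner ℂ (kernelVec p h1 h2) (basisVec a) = evalWord p a := by
  rw [← inner_conj_symm, inner_basisVec]
  simp [kernelVec]

theorem inner_kernelVec_eq_evalLinear {x : Fock n m} (hx : x ∈ finiteVectors n m) :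
    inner ℂ (kernelVec p h1 h2) x = evalLinear p x := by
  induction hx using Submodule.span_induction with
  | mem x hx =>
    obtain ⟨a, rfl⟩ := hx
    rw [inner_kernelVec_basisVec, evalLinear_basisVec]
  | zero => simp
  | add x y _ _ hx hy => rw [inner_add_right, hx, hy, map_add]
  | smul c x _ hx => rw [inner_smul_right, hx, map_smul, smul_eq_mul]

theorem inner_kernelVec_vacuum : inner ℂ (kernelVec p h1 h2) vacuum = 1 := by
  rw [inner_kernelVec_eq_evalLinear h1 h2 vacuum_mem, evalLinear_vacuum]

/-- Here evaluation is bounded, so the eigenvalue relation passes from basis vectors to the whole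
Fock space: the kernel vector is a common eigenvector of all adjoints. -/
theorem inner_kernelVec_apply (hp : p ∈ variety u) (T : polyAlg u) (x : Fock n m) :
    inner ℂ (kernelVec p h1 h2) (T.1 x) =
      polyChar ⟨p, hp⟩ T * inner ℂ (kernelVec p h1 h2) x := by
  have h : (innerSL ℂ (kernelVec p h1 h2)).comp T.1 =
      polyChar ⟨p, hp⟩ T • innerSL ℂ (kernelVec p h1 h2) := by
    refine clm_ext_basisVec fun a => ?_
    have hx := basisVec_mem a
    have hT := (polyAlg_le_evalSubalgebra hp T.2 _ hx).1
    simp only [ContinuousLinearMap.comp_apply, innerSL_apply_apply, smul_apply,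
      smul_eq_mul]
    rw [inner_kernelVec_eq_evalLinear h1 h2 hT, inner_kernelVec_eq_evalLinear h1 h2 hx]
    exact polyChar_eval ⟨p, hp⟩ T hx
  simpa using DFunLike.congr_fun h x

theorem norm_polyChar_le_of_lt_one
    {p : EuclideanSpace ℂ (Fin n) × EuclideanSpace ℂ (Fin m)} (h1 : ‖p.1‖ < 1) (h2 : ‖p.2‖ < 1)
    (hp : p ∈ variety u) (T : polyAlg u) :
    ‖polyChar ⟨p, hp⟩ T‖ ≤ ‖T‖ := by
  set ν := kernelVec p h1 h2 with hν
  have hne : ν ≠ 0 := by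
    intro h0
    have h := inner_kernelVec_vacuum h1 h2
    rw [← hν, h0, inner_zero_left] at h
    exact zero_ne_one h
  have hpos : 0 < ‖ν‖ ^ 2 := by positivity
  -- Testing the eigenvalue relation on the kernel vector itself, then Cauchy–Schwarz.
  have h := congrArg norm (inner_kernelVec_apply h1 h2 hp T ν)
  rw [← hν, norm_mul, inner_self_eq_norm_sq_to_K] at h
  have h3 : ‖((‖ν‖ : ℂ)) ^ 2‖ = ‖ν‖ ^ 2 := by simp
  have h4 : ‖inner ℂ ν (T.1 ν)‖ ≤ ‖T‖ * ‖ν‖ ^ 2 := by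
    refine (norm_inner_le_norm _ _).trans ?_
    have := mul_le_mul_of_nonneg_left (T.1.le_opNorm ν) (norm_nonneg ν)
    refine this.trans_eq ?_
    rw [show ‖T‖ = ‖T.1‖ from rfl]
    ring
  rw [h] at h4
  refine le_of_mul_le_mul_right ?_ hpos
  simpa using h4

end kernelVec

/-! ### Characters of the norm closure -/

/-- The elements with continuous value form a subalgebra, and on the generators the value is a
coordinate. -/
theorem continuous_polyChar (T : polyAlg u) : Continuous fun p : variety u => polyChar p T := by
  let S : Subalgebra ℂ (polyAlg u) :=
    { carrier := {T | Continuous fun p : variety u => polyChar p T}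
      mul_mem' := fun {a b} ha hb =>
        (Continuous.mul ha hb).congr fun p => (map_mul (polyChar p) a b).symm
      add_mem' := fun {a b} ha hb =>
        (Continuous.add ha hb).congr fun p => ((polyChar p).toLinearMap.map_add a b).symm
      algebraMap_mem' := fun c =>
        continuous_const.congr fun p => ((polyChar p).commutes c).symm }
  refine mem_of_gen_mem (S := S) (fun i => ?_) (fun j => ?_) T
  · change Continuous fun p : variety u => polyChar p (genE u i)
    simp only [polyChar_genE]
    fun_prop
  · change Continuous fun p : variety u => polyChar p (genF u j)
    simp only [polyChar_genF]
    fun_prop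

theorem smul_mem_variety {p : EuclideanSpace ℂ (Fin n) × EuclideanSpace ℂ (Fin m)}
    (hp : p ∈ variety u) (t : ℝ) : ((t : ℂ) • p) ∈ variety u := by
  intro i j
  have h := congrArg (fun c => (t : ℂ) * t * c) (hp i j)
  simp only [Prod.smul_fst, Prod.smul_snd, PiLp.smul_apply, smul_eq_mul]
  rw [mul_mul_mul_comm, h, Finset.mul_sum]
  exact Finset.sum_congr rfl fun c _ => by ring

/-- On the boundary there need be no kernel vector. The point is approached along the ray `t • p`,
`t → 1` from below, which stays on the variety and enters the open balls. -/
theorem norm_polyChar_le {p : EuclideanSpace ℂ (Fin n) × EuclideanSpace ℂ (Fin m)}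
    (hp : p ∈ omega u) (T : polyAlg u) : ‖polyChar ⟨p, hp.1⟩ T‖ ≤ ‖T‖ := by
  have h1 : ‖p.1‖ ≤ 1 := by simpa using hp.2.1
  have h2 : ‖p.2‖ ≤ 1 := by simpa using hp.2.2
  let γ : ℝ → variety u := fun t => ⟨(t : ℂ) • p, smul_mem_variety hp.1 t⟩
  have hγ : Continuous γ := by
    refine Continuous.subtype_mk ?_ _
    fun_prop
  have hγ1 : γ 1 = ⟨p, hp.1⟩ := Subtype.ext (by simp [γ])
  have hlim : Tendsto (fun t => ‖polyChar (γ t) T‖) (𝓝[<] 1) (𝓝 ‖polyChar (γ 1) T‖) :=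
    (((continuous_polyChar T).comp hγ).norm.tendsto 1).mono_left nhdsWithin_le_nhds
  rw [← hγ1]
  refine le_of_tendsto hlim ?_
  have hmem : Set.Ioo (0 : ℝ) 1 ∈ 𝓝[<] (1 : ℝ) := Ioo_mem_nhdsLT zero_lt_one
  filter_upwards [hmem] with t ht
  have hlt : ∀ r : ℝ, 0 ≤ r → r ≤ 1 → t * r < 1 := fun r hr hr' =>
    lt_of_le_of_lt (mul_le_of_le_one_right ht.1.le hr') ht.2
  refine norm_polyChar_le_of_lt_one ?_ ?_ _ T
  · rw [Prod.smul_fst, norm_smul, Complex.norm_real, Real.norm_of_nonneg ht.1.le]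
    exact hlt _ (norm_nonneg _) h1
  · rw [Prod.smul_snd, norm_smul, Complex.norm_real, Real.norm_of_nonneg ht.1.le]
    exact hlt _ (norm_nonneg _) h2

instance completeSpace_normAlg : CompleteSpace (normAlg u) :=
  (Subalgebra.isClosed_topologicalClosure (polyAlg u)).completeSpace_coe

/-- The inclusion of `ℂ[𝔽_u⁺]` into its norm closure. -/
abbrev polyIncl (u : Matrix.unitaryGroup (Fin n × Fin m) ℂ) : polyAlg u →ₐ[ℂ] normAlg u :=
  Subalgebra.inclusion (polyAlg_le_normAlg u)

theorem denseRange_polyIncl : DenseRange (polyIncl u) :=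
  denseRange_inclusion_iff (polyAlg_le_normAlg u) |>.mpr subset_rfl

/-- The point of a character of the norm closure. -/
def normPoint (φ : WeakDual.characterSpace ℂ (normAlg u)) :
    EuclideanSpace ℂ (Fin n) × EuclideanSpace ℂ (Fin m) :=
  pointOf u fun x => φ (polyIncl u x)

instance nontrivial_fock : Nontrivial (Fock n m) :=
  ⟨vacuum, 0, fun h => by
    have := (orthonormal_basisVec (n := n) (m := m)).1 ([], [])
    rw [show basisVec ([], []) = (vacuum : Fock n m) from rfl, h, norm_zero] at this
    exact zero_ne_one this⟩

instance normOneClass_normAlg : NormOneClass (normAlg u) :=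
  ⟨norm_one (α := Fock n m →L[ℂ] Fock n m)⟩

theorem norm_character_le (φ : WeakDual.characterSpace ℂ (normAlg u)) (x : normAlg u) :
    ‖φ x‖ ≤ ‖x‖ :=
  AlgHom.norm_apply_le_self φ x

/-- The restriction of a character to `ℂ[𝔽_u⁺]`. -/
def restrictPoly (φ : WeakDual.characterSpace ℂ (normAlg u)) : polyAlg u →ₐ[ℂ] ℂ :=
  (WeakDual.CharacterSpace.toAlgHom φ).comp (polyIncl u)

theorem norm_restrictPoly_le (φ : WeakDual.characterSpace ℂ (normAlg u)) (T : polyAlg u) :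
    ‖restrictPoly φ T‖ ≤ ‖T.1‖ :=
  norm_character_le φ _

/-- The coordinatewise conjugate of a vector. -/
def conjVec {ι : Type*} (z : EuclideanSpace ℂ ι) : EuclideanSpace ℂ ι :=
  WithLp.toLp 2 fun i => (starRingEnd ℂ) (z i)

theorem norm_conjVec {ι : Type*} [Fintype ι] (z : EuclideanSpace ℂ ι) : ‖conjVec z‖ = ‖z‖ := by
  simp [EuclideanSpace.norm_eq, conjVec]

theorem sum_conjVec_mul {ι : Type*} [Fintype ι] (z : EuclideanSpace ℂ ι) :
    ∑ i, conjVec z i * z i = ((‖z‖ ^ 2 : ℝ) : ℂ) := by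
  rw [EuclideanSpace.norm_sq_eq]
  push_cast
  exact Finset.sum_congr rfl fun i _ => by simp [conjVec, Complex.conj_mul']

theorem algHom_opE_conjVec (φ : polyAlg u →ₐ[ℂ] ℂ) :
    φ ⟨opE (conjVec (pointOf u φ).1), opE_mem u _⟩ = ((‖(pointOf u φ).1‖ ^ 2 : ℝ) : ℂ) := by
  rw [opE_eq_sum, ← sum_conjVec_mul]
  simp only [map_sum, AlgHom.map_smul_of_tower, smul_eq_mul]
  rfl

theorem algHom_opF_conjVec (φ : polyAlg u →ₐ[ℂ] ℂ) :
    φ ⟨opF u (conjVec (pointOf u φ).2), opF_mem u _⟩ = ((‖(pointOf u φ).2‖ ^ 2 : ℝ) : ℂ) := by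
  rw [opF_eq_sum, ← sum_conjVec_mul]
  simp only [map_sum, AlgHom.map_smul_of_tower, smul_eq_mul]
  rfl

theorem le_one_of_sq_le_self {r : ℝ} (h : r ^ 2 ≤ r) : r ≤ 1 := by
  by_contra! h1
  nlinarith

/-- Contractivity on the creation operator of the conjugate vector gives `r² ≤ r` for the norm `r`
of each component. -/
theorem normPoint_mem_omega (φ : WeakDual.characterSpace ℂ (normAlg u)) :
    normPoint φ ∈ omega u := by
  refine ⟨pointOf_mem_variety (restrictPoly φ), ?_, ?_⟩
  · rw [mem_closedBall_zero_iff]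
    have h := norm_restrictPoly_le φ ⟨opE (conjVec (normPoint φ).1), opE_mem u _⟩
    have h' := h.trans ((norm_opE_le _).trans_eq (norm_conjVec _))
    have e := algHom_opE_conjVec (restrictPoly φ)
    change restrictPoly φ ⟨opE (conjVec (normPoint φ).1), opE_mem u _⟩ =
      ((‖(normPoint φ).1‖ ^ 2 : ℝ) : ℂ) at e
    rw [e, Complex.norm_real, Real.norm_of_nonneg (by positivity)] at h'
    exact le_one_of_sq_le_self h'
  · rw [mem_closedBall_zero_iff]
    have h := norm_restrictPoly_le φ ⟨opF u (conjVec (normPoint φ).2), opF_mem u _⟩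
    have h' := h.trans ((norm_opF_le u _).trans_eq (norm_conjVec _))
    have e := algHom_opF_conjVec (restrictPoly φ)
    change restrictPoly φ ⟨opF u (conjVec (normPoint φ).2), opF_mem u _⟩ =
      ((‖(normPoint φ).2‖ ^ 2 : ℝ) : ℂ) at e
    rw [e, Complex.norm_real, Real.norm_of_nonneg (by positivity)] at h'
    exact le_one_of_sq_le_self h'

theorem normPoint_injective :
    Function.Injective (normPoint (u := u)) := by
  intro φ ψ h
  have hr : restrictPoly φ = restrictPoly ψ := pointOf_injective h
  have heq : (φ : normAlg u → ℂ) = ψ := by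
    refine denseRange_polyIncl.equalizer (map_continuous φ) (map_continuous ψ) ?_
    funext T
    exact DFunLike.congr_fun hr T
  exact DFunLike.coe_injective heq

theorem continuous_normPoint : Continuous (normPoint (u := u)) := by
  have h : ∀ x : normAlg u, Continuous fun φ : WeakDual.characterSpace ℂ (normAlg u) => φ x :=
    fun x => (WeakDual.eval_continuous x).comp continuous_subtype_val
  unfold normPoint pointOf
  refine Continuous.prodMk ?_ ?_
  · exact (PiLp.continuous_toLp 2 _).comp (continuous_pi fun i => h _)
  · exact (PiLp.continuous_toLp 2 _).comp (continuous_pi fun j => h _)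

theorem exists_character (p : omega u) :
    ∃ φ : WeakDual.characterSpace ℂ (normAlg u), normPoint φ = p.1 := by
  let χ : polyAlg u →ₐ[ℂ] ℂ := polyChar ⟨p.1, p.2.1⟩
  let ext : normAlg u →L[ℂ] ℂ := χ.toLinearMap.extendOfNorm (polyIncl u).toLinearMap
  have hd : DenseRange (polyIncl u).toLinearMap := denseRange_polyIncl (u := u)
  have hext : ∀ T, ext (polyIncl u T) = χ T := fun T =>
    LinearMap.extendOfNorm_eq hd
      ⟨1, fun x => by rw [one_mul]; exact norm_polyChar_le p.2 x⟩ T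
  have hmul : ∀ x y, ext (x * y) = ext x * ext y := by
    intro x y
    refine denseRange_polyIncl.induction_on₂ (p := fun x y => ext (x * y) = ext x * ext y)
      ?_ ?_ x y
    · exact isClosed_eq (by fun_prop) (by fun_prop)
    · intro S T
      rw [← map_mul, hext, hext, hext, map_mul]
  have hone : ext 1 = 1 := by
    have h := hext 1
    rwa [map_one (polyIncl u), map_one χ] at h
  refine ⟨⟨StrongDual.toWeakDual ext, ?_, hmul⟩, ?_⟩
  · intro h
    have h' : ext 1 = 0 := DFunLike.congr_fun h 1
    rw [hone] at h'
    exact one_ne_zero h'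
  · have h : (fun x => ext (polyIncl u x)) = fun x => χ x := funext hext
    change pointOf u (fun x => ext (polyIncl u x)) = p.1
    rw [h]
    exact pointOf_polyChar _

/-- The homeomorphism of the character space of `𝒜_u` with `Ω_u`. -/
def characterHomeo (u : Matrix.unitaryGroup (Fin n × Fin m) ℂ) :
    WeakDual.characterSpace ℂ (normAlg u) ≃ₜ omega u :=
  Continuous.homeoOfEquivCompactToT2
    (f := Equiv.ofBijective (fun φ => (⟨normPoint φ, normPoint_mem_omega φ⟩ : omega u))
      ⟨fun _ _ h => normPoint_injective (congrArg Subtype.val h),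
        fun p => (exists_character p).imp fun _ h => Subtype.ext h⟩)
    (continuous_normPoint.subtype_mk _)

theorem characterHomeo_apply (φ : WeakDual.characterSpace ℂ (normAlg u)) :
    (characterHomeo u φ).1 = normPoint φ := rfl

/-! ### Points of the open balls -/

/-- The vector functional `T ↦ ⟨x, T y⟩` as a normal functional. -/
def vectorPair {H : Type*} [NormedAddCommGroup H] [InnerProductSpace ℂ H] (x y : H) :
    SqSummablePair H :=
  ⟨(fun k => if k = 0 then x else 0, fun k => if k = 0 then y else 0),
    summable_of_ne_finset_zero (s := {0}) (fun k hk => by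
      have : k ≠ 0 := by simpa using hk
      simp [this]),
    summable_of_ne_finset_zero (s := {0}) (fun k hk => by
      have : k ≠ 0 := by simpa using hk
      simp [this])⟩

theorem normalFunctional_vectorPair {H : Type*} [NormedAddCommGroup H] [InnerProductSpace ℂ H]
    (x y : H) (T : H →L[ℂ] H) : normalFunctional (vectorPair x y) T = inner ℂ x (T y) := by
  unfold normalFunctional
  rw [tsum_eq_single 0 (fun k hk => by simp [vectorPair, hk])]
  simp [vectorPair]

theorem weakStar_continuous_inner {H : Type*} [NormedAddCommGroup H] [InnerProductSpace ℂ H]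
    (x y : H) : @Continuous _ _ (weakStar H) _ (fun T : H →L[ℂ] H => inner ℂ x (T y)) := by
  let := weakStar H
  exact (weakStar_continuous_normalFunctional (vectorPair x y)).congr
    (normalFunctional_vectorPair x y)

/-- For fixed `x` both sides are weak-star continuous in `T`, so the relation survives the closure.
With `x = S vacuum` it yields multiplicativity on `ℒ_u`. -/
theorem inner_kernelVec_of_mem_weakAlg
    {p : EuclideanSpace ℂ (Fin n) × EuclideanSpace ℂ (Fin m)} (h1 : ‖p.1‖ < 1) (h2 : ‖p.2‖ < 1)
    (hp : p ∈ variety u) {T : Fock n m →L[ℂ] Fock n m} (hT : T ∈ weakAlg u) (x : Fock n m) :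
    inner ℂ (kernelVec p h1 h2) (T x) =
      inner ℂ (kernelVec p h1 h2) (T vacuum) * inner ℂ (kernelVec p h1 h2) x := by
  let := weakStar (Fock n m)
  have hcl : IsClosed {T : Fock n m →L[ℂ] Fock n m | inner ℂ (kernelVec p h1 h2) (T x) =
      inner ℂ (kernelVec p h1 h2) (T vacuum) * inner ℂ (kernelVec p h1 h2) x} :=
    isClosed_eq (weakStar_continuous_inner _ _)
      ((weakStar_continuous_inner _ _).mul continuous_const)
  refine closure_minimal (fun S hS => ?_) hcl hT
  have h := inner_kernelVec_apply h1 h2 hp ⟨S, hS⟩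
  change inner ℂ (kernelVec p h1 h2) (S x) = _
  have hv := h vacuum
  rw [inner_kernelVec_vacuum, mul_one] at hv
  change inner ℂ (kernelVec p h1 h2) (S vacuum) = _ at hv
  rw [hv]
  exact h x

theorem extendsWeakStar_of_lt_one (φ : WeakDual.characterSpace ℂ (normAlg u))
    (h1 : ‖(normPoint φ).1‖ < 1) (h2 : ‖(normPoint φ).2‖ < 1) : ExtendsWeakStar u φ := by
  have hp := (normPoint_mem_omega φ).1
  set ν := kernelVec (normPoint φ) h1 h2 with hν
  let ψ : weakAlg u →ₗ[ℂ] ℂ :=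
    { toFun := fun T => inner ℂ ν (T.1 vacuum)
      map_add' := fun S T => by simp
      map_smul' := fun c T => by simp }
  refine ⟨ψ, fun h => ?_, fun S T => ?_, ?_, fun x => ?_⟩
  · have h0 : inner ℂ ν (vacuum : Fock n m) = 0 := DFunLike.congr_fun h (1 : weakAlg u)
    rw [hν, inner_kernelVec_vacuum] at h0
    exact one_ne_zero h0
  · exact inner_kernelVec_of_mem_weakAlg h1 h2 hp S.2 (T.1 vacuum)
  · let := weakStar (Fock n m)
    exact (weakStar_continuous_inner ν vacuum).comp continuous_subtype_val
  · have hr : restrictPoly φ = polyChar ⟨normPoint φ, hp⟩ :=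
      pointOf_injective (pointOf_polyChar ⟨normPoint φ, hp⟩).symm
    have heq : (fun x : normAlg u => inner ℂ ν (x.1 vacuum)) = φ := by
      refine denseRange_polyIncl.equalizer ?_ (map_continuous φ) ?_
      · have : Continuous fun T : Fock n m →L[ℂ] Fock n m => inner ℂ ν (T vacuum) := by fun_prop
        exact this.comp continuous_subtype_val
      · funext T
        have h := inner_kernelVec_apply h1 h2 hp T vacuum
        rw [inner_kernelVec_vacuum, mul_one, ← hr] at h
        exact h
    exact congrFun heq x

/-! ### Powers of creation operators tend to zero -/

/-- The vectors whose coordinates of degree less than `k` vanish. -/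
def degreeGE (g : Word n m → ℕ) (k : ℕ) : Submodule ℂ (Fock n m) where
  carrier := {x | ∀ a, g a < k → x a = 0}
  add_mem' := fun {x y} hx hy a ha => by simp [hx a ha, hy a ha]
  zero_mem' := fun a _ => rfl
  smul_mem' := fun c x hx a ha => by simp [hx a ha]

theorem degreeGE_anti (g : Word n m → ℕ) : Antitone (degreeGE g) :=
  fun _ _ h _ hx a ha => hx a (ha.trans_le h)

theorem basisVec_mem_degreeGE {g : Word n m → ℕ} {k : ℕ} {a : Word n m} (h : k ≤ g a) :
    basisVec a ∈ degreeGE g k := by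
  intro b hb
  have hab : b ≠ a := by rintro rfl; omega
  rw [← inner_basisVec]
  exact orthonormal_basisVec.inner_eq_zero hab

theorem map_mem_degreeGE (g : Word n m → ℕ) {k k' : ℕ} (T : Fock n m →L[ℂ] Fock n m)
    (hT : ∀ a, k ≤ g a → T (basisVec a) ∈ degreeGE g k') {x : Fock n m}
    (hx : x ∈ degreeGE g k) : T x ∈ degreeGE g k' := by
  intro b hb
  have h := ((hasSum_basisVec x).mapL T).mapL (innerSL ℂ (basisVec b))
  rw [innerSL_apply_apply, inner_basisVec] at h
  refine h.unique ?_
  convert hasSum_zero with a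
  by_cases ha : g a < k
  · simp [hx a ha]
  · rw [map_smul, map_smul, innerSL_apply_apply, inner_basisVec, hT a (not_lt.mp ha) b hb,
      smul_zero]

theorem pow_mem_degreeGE (g : Word n m → ℕ) (T : Fock n m →L[ℂ] Fock n m)
    (hT : ∀ a, T (basisVec a) ∈ degreeGE g (g a + 1)) (k : ℕ) (x : Fock n m) :
    (T ^ k) x ∈ degreeGE g k := by
  induction k with
  | zero => intro a ha; simp at ha
  | succ k ih =>
    rw [pow_succ']
    exact map_mem_degreeGE g T
      (fun a ha => degreeGE_anti g (Nat.succ_le_succ ha) (hT a)) ih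

/-- Against a finite vector the inner product is eventually zero, because the degree has grown past
its support; the bound `‖T ^ k‖ ≤ 1` extends this to all `x` by density. -/
theorem tendsto_inner_pow (g : Word n m → ℕ) (T : Fock n m →L[ℂ] Fock n m)
    (hT : ∀ a, T (basisVec a) ∈ degreeGE g (g a + 1)) (hn : ‖T‖ ≤ 1) (x y : Fock n m) :
    Tendsto (fun k => inner ℂ x ((T ^ k) y)) atTop (𝓝 0) := by
  have hb : ∀ k, ‖(T ^ k) y‖ ≤ ‖y‖ := fun k => by
    refine ((T ^ k).le_opNorm y).trans (mul_le_of_le_one_left (norm_nonneg _) ?_)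
    exact (norm_pow_le T k).trans (pow_le_one₀ (norm_nonneg _) hn)
  have hfin : ∀ x ∈ finiteVectors n m,
      Tendsto (fun k => inner ℂ x ((T ^ k) y)) atTop (𝓝 0) := by
    intro x hx
    induction hx using Submodule.span_induction with
    | mem x hx =>
      obtain ⟨a, rfl⟩ := hx
      refine tendsto_const_nhds.congr' ?_
      filter_upwards [eventually_gt_atTop (g a)] with k hk
      rw [inner_basisVec, pow_mem_degreeGE g T hT k y a hk]
    | zero => simp
    | add x x' _ _ hx hx' => simpa [inner_add_left] using hx.add hx'
    | smul c x _ hx =>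
      simpa only [inner_smul_left, mul_zero] using hx.const_mul ((starRingEnd ℂ) c)
  rw [Metric.tendsto_atTop]
  intro ε hε
  obtain ⟨x', hx', hd⟩ := Metric.mem_closure_iff.mp (dense_span_basisVec x)
    -- The summand `1` keeps the denominator nonzero when `y = 0`.
    (ε / (2 * (‖y‖ + 1))) (by positivity)
  obtain ⟨N, hN⟩ := Metric.tendsto_atTop.mp (hfin x' hx') (ε / 2) (by positivity)
  refine ⟨N, fun k hk => ?_⟩
  have h1 := hN k hk
  rw [dist_zero_right] at h1 ⊢
  have h2 : inner ℂ x ((T ^ k) y) = inner ℂ (x - x') ((T ^ k) y) + inner ℂ x' ((T ^ k) y) := by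
    rw [inner_sub_left, sub_add_cancel]
  have h3 : ‖inner ℂ (x - x') ((T ^ k) y)‖ ≤ ε / 2 := by
    refine (norm_inner_le_norm _ _).trans ?_
    rw [dist_eq_norm] at hd
    calc ‖x - x'‖ * ‖(T ^ k) y‖ ≤ ε / (2 * (‖y‖ + 1)) * (‖y‖ + 1) :=
          mul_le_mul hd.le ((hb k).trans (by linarith)) (norm_nonneg _) (by positivity)
      _ = ε / 2 := by field_simp
  rw [h2]
  exact (norm_add_le _ _).trans_lt (by linarith)

/-- Termwise convergence is upgraded to normal functionals by dominated convergence, uniformly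
dominated since the powers are contractions. -/
theorem tendsto_weakStar_pow (g : Word n m → ℕ) (T : Fock n m →L[ℂ] Fock n m)
    (hT : ∀ a, T (basisVec a) ∈ degreeGE g (g a + 1)) (hn : ‖T‖ ≤ 1) :
    Tendsto (fun k => T ^ k) atTop (@nhds _ (weakStar (Fock n m)) 0) := by
  rw [nhds_induced, tendsto_comap_iff, tendsto_pi_nhds]
  intro p
  have h0 : normalFunctional p 0 = ∑' _ : ℕ, (0 : ℂ) := by simp [normalFunctional]
  rw [h0]
  refine tendsto_tsum_of_dominated_convergence (p.2.1.add p.2.2)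
    (fun k => tendsto_inner_pow g T hT hn _ _) (Eventually.of_forall fun j k => ?_)
  refine (norm_inner_le p (T ^ j) k).trans (mul_le_of_le_one_left (by positivity) ?_)
  exact (norm_pow_le T j).trans (pow_le_one₀ (norm_nonneg _) hn)

theorem opE_basisVec_mem (e : EuclideanSpace ℂ (Fin n)) (a : Word n m) :
    opE e (basisVec a) ∈ degreeGE (fun a => a.1.length) (a.1.length + 1) := by
  have h : opE e (basisVec a) = ∑ i, e i • basisVec ((i :: a.1, a.2) : Word n m) := by
    simp [opE, shiftE_basisVec]
  rw [h]
  exact Submodule.sum_mem _ fun i _ => Submodule.smul_mem _ _ (basisVec_mem_degreeGE (by simp))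

theorem shiftE_mem_degreeGE_snd (i : Fin n) {k : ℕ} {x : Fock n m}
    (hx : x ∈ degreeGE (fun a => a.2.length) k) :
    shiftE i x ∈ degreeGE (fun a => a.2.length) k :=
  map_mem_degreeGE _ (shiftE i).toContinuousLinearMap (fun a ha => by
    have h : (shiftE i).toContinuousLinearMap (basisVec a) = basisVec (i :: a.1, a.2) :=
      shiftE_basisVec i a
    rw [h]
    exact basisVec_mem_degreeGE ha) hx

/-- Moving `f` past letters `e` changes the letters but not how many `f`s there are. -/
theorem fTensor_mem_degreeGE (q : List (Fin m)) (r : List (Fin n)) : ∀ l : Fin m,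
    fTensor u q l r ∈ degreeGE (fun a : Word n m => a.2.length) (q.length + 1) := by
  induction r with
  | nil =>
    intro l
    exact basisVec_mem_degreeGE (by simp)
  | cons k r ih =>
    intro l
    exact Submodule.sum_mem _ fun c _ =>
      Submodule.smul_mem _ _ (shiftE_mem_degreeGE_snd _ (ih c.2))

theorem opF_basisVec_mem (f : EuclideanSpace ℂ (Fin m)) (a : Word n m) :
    opF u f (basisVec a) ∈ degreeGE (fun a => a.2.length) (a.2.length + 1) := by
  have h : opF u f (basisVec a) = ∑ l, f l • fTensor u a.2 l a.1 := by
    simp [opF, shiftF_basisVec]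
  rw [h]
  exact Submodule.sum_mem _ fun l _ => Submodule.smul_mem _ _ (fTensor_mem_degreeGE _ _ l)

/-- A character with a weak-star continuous extension does not take the value one at an element
whose powers tend to zero. -/
theorem ExtendsWeakStar.ne_one {φ : WeakDual.characterSpace ℂ (normAlg u)}
    (hφ : ExtendsWeakStar u φ) (T : polyAlg u)
    (hT : Tendsto (fun k => T.1 ^ k) atTop (@nhds _ (weakStar (Fock n m)) 0)) :
    restrictPoly φ T ≠ 1 := by
  obtain ⟨ψ, -, hmul, hcont, hext⟩ := hφ
  intro h1
  let S : weakAlg u := Subalgebra.inclusion (normAlg_le_weakAlg u) (polyIncl u T)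
  -- Powers start at `1`, so that `ψ 1 = 1` is not needed.
  have hψS : ∀ k : ℕ, ψ (S ^ (k + 1)) = 1 := by
    have hS : ψ S = 1 := (hext _).trans h1
    intro k
    induction k with
    | zero => rw [zero_add, pow_one, hS]
    | succ k ih => rw [pow_succ, hmul, ih, hS, one_mul]
  let := weakStar (Fock n m)
  have hlim : Tendsto (fun k : ℕ => S ^ (k + 1)) atTop (𝓝 (0 : weakAlg u)) := by
    rw [tendsto_subtype_rng]
    exact hT.comp (tendsto_add_atTop_nat 1)
  have h2 := (hcont.tendsto 0).comp hlim
  rw [map_zero] at h2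
  have h3 : Tendsto (fun _ : ℕ => (1 : ℂ)) atTop (𝓝 0) := h2.congr hψS
  exact one_ne_zero (tendsto_nhds_unique tendsto_const_nhds h3)

theorem ExtendsWeakStar.lt_one {φ : WeakDual.characterSpace ℂ (normAlg u)}
    (hφ : ExtendsWeakStar u φ) : ‖(normPoint φ).1‖ < 1 ∧ ‖(normPoint φ).2‖ < 1 := by
  have hm := (normPoint_mem_omega φ).2
  have h1 : ‖(normPoint φ).1‖ ≤ 1 := by simpa using hm.1
  have h2 : ‖(normPoint φ).2‖ ≤ 1 := by simpa using hm.2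
  refine ⟨lt_of_le_of_ne h1 fun h => ?_, lt_of_le_of_ne h2 fun h => ?_⟩
  · refine hφ.ne_one ⟨opE (conjVec (normPoint φ).1), opE_mem u _⟩
      (tendsto_weakStar_pow _ _ (opE_basisVec_mem _) ?_) ?_
    · exact (norm_opE_le _).trans ((norm_conjVec _).trans_le h1)
    · have e := algHom_opE_conjVec (restrictPoly φ)
      change _ = ((‖(normPoint φ).1‖ ^ 2 : ℝ) : ℂ) at e
      rw [h, one_pow, Complex.ofReal_one] at e
      exact e
  · refine hφ.ne_one ⟨opF u (conjVec (normPoint φ).2), opF_mem u _⟩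
      (tendsto_weakStar_pow _ _ (opF_basisVec_mem _) ?_) ?_
    · exact (norm_opF_le u _).trans ((norm_conjVec _).trans_le h2)
    · have e := algHom_opF_conjVec (restrictPoly φ)
      change _ = ((‖(normPoint φ).2‖ ^ 2 : ℝ) : ℂ) at e
      rw [h, one_pow, Complex.ofReal_one] at e
      exact e

end UnitaryRelation
end

open UnitaryRelation in
theorem proposition3p1 (n m : ℕ) (u : Matrix.unitaryGroup (Fin n × Fin m) ℂ) :
    Set.BijOn (fun φ : polyAlg u →ₗ[ℂ] ℂ => pointOf u φ) (polyCharacters u) (variety u) ∧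
    ∃ h : WeakDual.characterSpace ℂ (normAlg u) ≃ₜ omega u,
      (∀ φ, (h φ : EuclideanSpace ℂ (Fin n) × EuclideanSpace ℂ (Fin m)) =
        pointOf u (fun x => φ (Subalgebra.inclusion (polyAlg_le_normAlg u) x))) ∧
      ∀ p : omega u, ExtendsWeakStar u (h.symm p) ↔
        p.1 ∈ Metric.ball (0 : EuclideanSpace ℂ (Fin n)) 1 ×ˢ
          Metric.ball (0 : EuclideanSpace ℂ (Fin m)) 1 := by
  refine ⟨bijOn_polyCharacters u, characterHomeo u, characterHomeo_apply, fun p => ?_⟩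
  have hp : normPoint ((characterHomeo u).symm p) = p.1 := by
    rw [← characterHomeo_apply, Homeomorph.apply_symm_apply]
  rw [Set.mem_prod, mem_ball_zero_iff, mem_ball_zero_iff, ← hp]
  exact ⟨fun h => h.lt_one, fun h => extendsWeakStar_of_lt_one _ h.1 h.2⟩
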